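/- **Theorem 2.2 (stability of the Tikhonov-regularized solution).** Let $M\ge 1$, let $\Omega\subset\mathbb R^M$ be open and bounded, and let $\Omega_1\subset\Omega$ be open and connected (non-empty) with Lipschitz boundary. Let $\gamma>0$, $0<\underline a<\overline a$, $\rho>0$, and let $C_F>0$ be a constant such that $$\|v\|_{H^1(\Omega_1)}^2\le C_F\Big[\int_{\Omega_1}|\nabla v|^2+\int_{\partial\Omega_1}v^2\Big]\qquad\forall v\in H^1(\Omega_1).$$ Let $0<\overline b<\underline a\min\{1,\gamma\}/C_F$, let $b\in L^\infty(\Omega)$ with $0<b(x)<\overline b$ a.e. on $\Omega$, let $f\in L^\infty(\Omega)$ and $a^*\in L^2(\Omega)$. (Boundary values of $H^1(\Omega_1)$ functions are traces, and $\partial\Omega_1$ carries the surface measure.) Let $\mathbb A$ be the set of measurable functions $a$ with $\underline a\le a\le\overline a$ a.e. on $\Omega$ and a.e. on $\partial\Omega_1$ (the values of $a$ on $\partial\Omega_1$ are part of $a$). For $a\in\mathbb A$ let $U(a)\in H^1(\Omega_1)$ be the weak solution of $-\mathrm{div}(a\nabla u)-bu=f$ in $\Omega_1$, $\nabla u\cdot\vec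 n+\gamma u=0$ on $\partial\Omega_1$, i.e. $$\int_{\Omega_1}a\nabla U(a)\cdot\nabla v+\int_{\partial\Omega_1}a\gamma\,U(a)v-\int_{\Omega_1}b\,U(a)v=\int_{\Omega_1}fv\qquad\forall v\in H^1(\Omega_1),$$ and for $z\in H^1(\Omega_1)$ put $$J_z(a)=\tfrac12\int_{\Omega_1}a|\nabla(U(a)-z)|^2+\tfrac12\int_{\partial\Omega_1}a\gamma(U(a)-z)^2-\tfrac12\int_{\Omega_1}b(U(a)-z)^2+\rho\|a-a^*\|_{L^2(\Omega)}^2 .$$ Let $z_n\to z^\delta$ in $H^1(\Omega_1)$. Then: 1. for every $a\in\mathbb A$ the weak solution $U(a)$ exists and is unique; 2. $J_{z^\delta}$ has a minimizer over $\mathbb A$; 3. if $a_n$ is a minimizer of $J_{z_n}$ over $\mathbb A$ for every $n$, and $a^\delta_\rho$ is a minimizer of $J_{z^\delta}$ over $\mathbb A$, then $\|a_n-a^\delta_\rho\|_{L^2(\Omega)}\to0$. In particular $a^\delta_\rho$ is unique as an element of $L^2(\Omega)$. The same holds if in both places $\mathbb A$ is replaced by any convex subset $\mathcal A\subseteq\mathbb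 A$ (for instance the one with strict bounds $\underline a<a<\overline a$, or the one of functions with prescribed values on $\partial\Omega_1$), for minimizers over $\mathcal A$. -/

import Mathlib

open MeasureTheory Filter Topology Set
open scoped ENNReal ContDiff

namespace RobinTikhonov

/-- The Euclidean space `ℝ^M`. -/
abbrev E (M : ℕ) : Type := EuclideanSpace ℝ (Fin M)

/-- `Ω` has Lipschitz boundary: near every boundary point there is a direction `e` such that `Ω` is
the set of points lying below the graph, in direction `e`, of a Lipschitz function `h` that does not
depend on the coordinate in direction `e`. -/
def HasLipschitzBoundary {M : ℕ} (Ω : Set (E M)) : Prop :=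
  ∀ x₀ ∈ frontier Ω, ∃ (e : E M) (h : E M → ℝ) (K : NNReal) (r : ℝ),
    ‖e‖ = 1 ∧ LipschitzWith K h ∧ (∀ (x : E M) (t : ℝ), h (x + t • e) = h x) ∧ 0 < r ∧
      ∀ x ∈ Metric.ball x₀ r, x ∈ Ω ↔ inner ℝ e x < h x

/-- Lebesgue measure on `Ω`. -/
noncomputable abbrev vol {M : ℕ} (Ω : Set (E M)) : Measure (E M) := volume.restrict Ω

/-- Surface measure on `∂Ω`: the `(M-1)`-dimensional Hausdorff measure, normalised so that it agrees
with Lebesgue measure on `ℝ^(M-1)`. -/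
noncomputable abbrev surf {M : ℕ} (Ω : Set (E M)) : Measure (E M) :=
  (Measure.euclideanHausdorffMeasure (M - 1)).restrict (frontier Ω)

/-- `g` is the weak gradient of `v` on `Ω` (both square integrable): integration by parts holds
against all smooth functions with compact support in `Ω`. -/
def IsWeakGradient {M : ℕ} (Ω : Set (E M)) (v : Lp ℝ 2 (vol Ω)) (g : Lp (E M) 2 (vol Ω)) : Prop :=
  ∀ ψ : E M → ℝ, ContDiff ℝ ∞ ψ → HasCompactSupport ψ → tsupport ψ ⊆ Ω →
    ∫ x in Ω, v x • gradient ψ x = - ∫ x in Ω, ψ x • g x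

theorem continuous_gradient {M : ℕ} {ψ : E M → ℝ} (hψ : ContDiff ℝ ∞ ψ) :
    Continuous (gradient ψ) :=
  (InnerProductSpace.toDual ℝ (E M)).symm.continuous.comp (hψ.continuous_fderiv (by simp))

theorem integrable_smul_gradient {M : ℕ} {Ω : Set (E M)} (v : Lp ℝ 2 (vol Ω)) {ψ : E M → ℝ}
    (hψ : ContDiff ℝ ∞ ψ) (hc : HasCompactSupport ψ) :
    Integrable (fun x => v x • gradient ψ x) (vol Ω) := by
  have h1 : HasCompactSupport (gradient ψ) :=
    (hc.fderiv (𝕜 := ℝ)).comp_left (g := (InnerProductSpace.toDual ℝ (E M)).symm) (by simp)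
  have h2 : MemLp (gradient ψ) 2 (vol Ω) := (continuous_gradient hψ).memLp_of_hasCompactSupport h1
  exact memLp_one_iff_integrable.1 (h2.smul (Lp.memLp v))

theorem integrable_smul_test {M : ℕ} {Ω : Set (E M)} (g : Lp (E M) 2 (vol Ω)) {ψ : E M → ℝ}
    (hψ : ContDiff ℝ ∞ ψ) (hc : HasCompactSupport ψ) :
    Integrable (fun x => ψ x • g x) (vol Ω) := by
  have h2 : MemLp ψ 2 (vol Ω) := hψ.continuous.memLp_of_hasCompactSupport hc
  exact memLp_one_iff_integrable.1 ((Lp.memLp g).smul h2)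

/-- The Sobolev space `H¹(Ω)`, as the space of pairs `(v, ∇v)` of a function `v ∈ L²(Ω)` and its
weak gradient `∇v ∈ L²(Ω; ℝ^M)` (which `v` determines). Its norm is
`‖v‖² = ∫_Ω v² + ∫_Ω |∇v|²`. -/
noncomputable def H1 {M : ℕ} (Ω : Set (E M)) :
    Submodule ℝ (WithLp 2 (Lp ℝ 2 (vol Ω) × Lp (E M) 2 (vol Ω))) where
  carrier := {p | IsWeakGradient Ω p.fst p.snd}
  zero_mem' := by
    intro ψ _ _ _
    have h1 : ∫ x in Ω, (0 : Lp ℝ 2 (vol Ω)) x • gradient ψ x = 0 := by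
      refine integral_eq_zero_of_ae ?_
      filter_upwards [Lp.coeFn_zero ℝ 2 (vol Ω)] with x hx
      simp only [hx, Pi.zero_apply, zero_smul]
    have h2 : ∫ x in Ω, ψ x • (0 : Lp (E M) 2 (vol Ω)) x = 0 := by
      refine integral_eq_zero_of_ae ?_
      filter_upwards [Lp.coeFn_zero (E M) 2 (vol Ω)] with x hx
      simp only [hx, Pi.zero_apply, smul_zero]
    change ∫ x in Ω, (0 : Lp ℝ 2 (vol Ω)) x • gradient ψ x
      = - ∫ x in Ω, ψ x • (0 : Lp (E M) 2 (vol Ω)) x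
    rw [h1, h2, neg_zero]
  add_mem' := by
    intro p q hp hq ψ hψ hc hs
    have h1 : ∫ x in Ω, (p.fst + q.fst) x • gradient ψ x
        = ∫ x in Ω, (p.fst x • gradient ψ x + q.fst x • gradient ψ x) := by
      refine integral_congr_ae ?_
      filter_upwards [Lp.coeFn_add p.fst q.fst] with x hx
      simp only [hx, Pi.add_apply, add_smul]
    have h2 : ∫ x in Ω, ψ x • (p.snd + q.snd) x
        = ∫ x in Ω, (ψ x • p.snd x + ψ x • q.snd x) := by
      refine integral_congr_ae ?_
      filter_upwards [Lp.coeFn_add p.snd q.snd] with x hx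
      simp only [hx, Pi.add_apply, smul_add]
    change ∫ x in Ω, (p.fst + q.fst) x • gradient ψ x = - ∫ x in Ω, ψ x • (p.snd + q.snd) x
    rw [h1, h2, integral_add (integrable_smul_gradient _ hψ hc) (integrable_smul_gradient _ hψ hc),
      integral_add (integrable_smul_test _ hψ hc) (integrable_smul_test _ hψ hc),
      hp ψ hψ hc hs, hq ψ hψ hc hs, neg_add]
  smul_mem' := by
    intro c p hp ψ hψ hc hs
    have h1 : ∫ x in Ω, (c • p.fst) x • gradient ψ x
        = ∫ x in Ω, c • (p.fst x • gradient ψ x) := by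
      refine integral_congr_ae ?_
      filter_upwards [Lp.coeFn_smul c p.fst] with x hx
      simp [hx, mul_smul]
    have h2 : ∫ x in Ω, ψ x • (c • p.snd) x = ∫ x in Ω, c • (ψ x • p.snd x) := by
      refine integral_congr_ae ?_
      filter_upwards [Lp.coeFn_smul c p.snd] with x hx
      simp [hx, smul_comm c]
    change ∫ x in Ω, (c • p.fst) x • gradient ψ x = - ∫ x in Ω, ψ x • (c • p.snd) x
    rw [h1, h2, integral_smul, integral_smul, hp ψ hψ hc hs, smul_neg]

/-- The function `v` of `v ∈ H¹(Ω)`. -/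
noncomputable abbrev fn {M : ℕ} {Ω : Set (E M)} (v : H1 Ω) : Lp ℝ 2 (vol Ω) := v.1.fst

/-- The weak gradient `∇v` of `v ∈ H¹(Ω)`. -/
noncomputable abbrev grad {M : ℕ} {Ω : Set (E M)} (v : H1 Ω) : Lp (E M) 2 (vol Ω) := v.1.snd

/-- A bounded linear map `χ : H¹(Ω) → L²(∂Ω)` with `χ u = u|_∂Ω` for every `u ∈ H¹(Ω)` that is
continuous up to the boundary. -/
def IsTraceOperator {M : ℕ} (Ω : Set (E M)) (χ : H1 Ω →L[ℝ] Lp ℝ 2 (surf Ω)) : Prop :=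
  ∀ (u : H1 Ω) (w : E M → ℝ), ContinuousOn w (closure Ω) → fn u =ᵐ[vol Ω] w → χ u =ᵐ[surf Ω] w

open Classical in
/-- The trace operator `H¹(Ω) → L²(∂Ω)`. On a bounded Lipschitz domain exactly one bounded linear
map has the property above. -/
noncomputable def trace {M : ℕ} (Ω : Set (E M)) : H1 Ω →L[ℝ] Lp ℝ 2 (surf Ω) :=
  if h : ∃ χ, IsTraceOperator Ω χ then h.choose else 0

/-- `C` is a constant in the Friedrichs inequality
`‖v‖²_{H¹(Ω)} ≤ C (∫_Ω |∇v|² + ∫_∂Ω v²)` for all `v ∈ H¹(Ω)`. -/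
def IsFriedrichsConstant {M : ℕ} (Ω : Set (E M)) (C : ℝ) : Prop :=
  ∀ v : H1 Ω, ‖v‖ ^ 2 ≤ C * ((∫ x in Ω, ‖grad v x‖ ^ 2) + ∫ x, (trace Ω v x) ^ 2 ∂(surf Ω))

/-- The admissible coefficients: measurable functions `a`, bounded by `aLow ≤ a ≤ aUp` almost
everywhere on `Ω` (volume measure) and almost everywhere on `∂Ω₁` (surface measure). -/
def admissible {M : ℕ} (Ω Ω₁ : Set (E M)) (aLow aUp : ℝ) : Set (E M → ℝ) :=
  {a | AEMeasurable a (vol Ω) ∧ AEMeasurable a (surf Ω₁) ∧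
    (∀ᵐ x ∂(vol Ω), aLow ≤ a x ∧ a x ≤ aUp) ∧ ∀ᵐ x ∂(surf Ω₁), aLow ≤ a x ∧ a x ≤ aUp}

/-- The bilinear form `∫_Ω₁ a ∇u·∇v + ∫_∂Ω₁ a γ u v - ∫_Ω₁ b u v`. -/
noncomputable def form {M : ℕ} (Ω₁ : Set (E M)) (γ : ℝ) (b a : E M → ℝ) (u v : H1 Ω₁) : ℝ :=
  (∫ x in Ω₁, a x * inner ℝ (grad u x) (grad v x))
    + (∫ x, a x * γ * (trace Ω₁ u x * trace Ω₁ v x) ∂(surf Ω₁))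
    - ∫ x in Ω₁, b x * (fn u x * fn v x)

/-- `u` is a weak solution of `-div (a ∇u) - b u = f` in `Ω₁`, `∇u·n + γ u = 0` on `∂Ω₁`. -/
def IsWeakSolution {M : ℕ} (Ω₁ : Set (E M)) (γ : ℝ) (b f a : E M → ℝ) (u : H1 Ω₁) : Prop :=
  ∀ v : H1 Ω₁, form Ω₁ γ b a u v = ∫ x in Ω₁, f x * fn v x

open Classical in
/-- The coefficient-to-solution map `a ↦ U(a)`. -/
noncomputable def U {M : ℕ} (Ω₁ : Set (E M)) (γ : ℝ) (b f a : E M → ℝ) : H1 Ω₁ :=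
  if h : ∃ u, IsWeakSolution Ω₁ γ b f a u then h.choose else 0

/-- The Tikhonov functional `a ↦ G_z(a) + ρ ‖a - a*‖²_{L²(Ω)}`, where
`G_z(a) = ½ ∫_Ω₁ a |∇(U(a)-z)|² + ½ ∫_∂Ω₁ a γ (U(a)-z)² - ½ ∫_Ω₁ b (U(a)-z)²`. -/
noncomputable def tikhonov {M : ℕ} (Ω Ω₁ : Set (E M)) (γ ρ : ℝ) (b f aStar : E M → ℝ)
    (z : H1 Ω₁) (a : E M → ℝ) : ℝ :=
  1 / 2 * form Ω₁ γ b a (U Ω₁ γ b f a - z) (U Ω₁ γ b f a - z)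
    + ρ * ∫ x in Ω, (a x - aStar x) ^ 2

end RobinTikhonov

namespace RobinTikhonov

section Boundary

open Metric

theorem euclideanHausdorffMeasure_image_lt_top {X Y : Type*} [EMetricSpace X] [MeasurableSpace X]
    [BorelSpace X] [EMetricSpace Y] [MeasurableSpace Y] [BorelSpace Y] {φ : X → Y} {K : NNReal}
    (hφ : LipschitzWith K φ) {d : ℕ} {s : Set X}
    (hs : Measure.euclideanHausdorffMeasure d s < ⊤) :
    Measure.euclideanHausdorffMeasure d (φ '' s) < ⊤ := by
  rw [Measure.euclideanHausdorffMeasure_def, Measure.smul_apply, ENNReal.smul_def,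
    smul_eq_mul] at hs ⊢
  have hs' : Measure.hausdorffMeasure (d : ℝ) s < ⊤ := by
    by_contra h
    rw [not_lt_top_iff.1 h, ENNReal.mul_top] at hs
    · exact lt_irrefl _ hs
    · exact_mod_cast Measure.addHaarScalarFactor_volume_hausdorffMeasure_ne_zero d
  refine ENNReal.mul_lt_top ENNReal.coe_lt_top
    ((hφ.hausdorffMeasure_image_le (Nat.cast_nonneg d) s).trans_lt
      (ENNReal.mul_lt_top (ENNReal.rpow_lt_top_of_nonneg (Nat.cast_nonneg d)
        ENNReal.coe_ne_top) hs'))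

/-- In a graph chart, the boundary is the graph. -/
theorem inner_eq_of_mem_frontier {M : ℕ} {Ω : Set (E M)} (hΩ : IsOpen Ω) {x₀ e : E M}
    {h : E M → ℝ} {r : ℝ} (hh : Continuous h)
    (hgraph : ∀ x ∈ ball x₀ r, x ∈ Ω ↔ inner ℝ e x < h x) {x : E M}
    (hx : x ∈ frontier Ω) (hxr : x ∈ ball x₀ r) : inner ℝ e x = h x := by
  rw [hΩ.frontier_eq] at hx
  refine le_antisymm (not_lt.1 fun hlt => ?_) (not_lt.1 fun hlt => hx.2 ((hgraph x hxr).2 hlt))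
  have ho : IsOpen (ball x₀ r ∩ {y | h y < inner ℝ e y}) :=
    isOpen_ball.inter (isOpen_lt hh (by fun_prop))
  obtain ⟨y, hy, hyΩ⟩ := mem_closure_iff.1 hx.1 _ ho ⟨hxr, hlt⟩
  exact lt_asymm hy.2 ((hgraph y hy.1).1 hyΩ)

/-- The boundary of a bounded open set with Lipschitz boundary has finite surface measure. -/
theorem isFiniteMeasure_surf {M : ℕ} (hM : 1 ≤ M) {Ω : Set (E M)} (hΩ : IsOpen Ω)
    (hb : Bornology.IsBounded Ω) (hLip : HasLipschitzBoundary Ω) : IsFiniteMeasure (surf Ω) := by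
  have hc : IsCompact (frontier Ω) :=
    hb.isCompact_closure.of_isClosed_subset isClosed_frontier frontier_subset_closure
  refine ⟨?_⟩
  rw [Measure.restrict_apply_univ]
  refine hc.measure_lt_top_of_nhdsWithin fun x₀ hx₀ => ?_
  obtain ⟨e, h, K, r, he, hK, hinv, hr, hgraph⟩ := hLip x₀ hx₀
  let W : Submodule ℝ (E M) := (ℝ ∙ e)ᗮ
  have hdim : Module.finrank ℝ W = M - 1 := by
    have : Fact (Module.finrank ℝ (E M) = (M - 1) + 1) := ⟨by simp; omega⟩
    exact Submodule.finrank_orthogonal_span_singleton (by rintro rfl; simp at he)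
  let φ : W → E M := fun y => (y : E M) + h y • e
  have hφ : LipschitzWith (1 + K) φ := by
    refine LipschitzWith.add (LipschitzWith.subtype_val _) ?_
    refine LipschitzWith.of_dist_le_mul fun x y => ?_
    rw [dist_eq_norm, ← sub_smul, norm_smul, he, mul_one, ← dist_eq_norm]
    exact hK.dist_le_mul x y
  have hfin : Measure.euclideanHausdorffMeasure (M - 1) (closedBall (0 : W) (‖x₀‖ + r)) < ⊤ := by
    rw [← hdim]
    exact (isCompact_closedBall _ _).measure_lt_top
  refine ⟨frontier Ω ∩ ball x₀ r, inter_mem_nhdsWithin _ (ball_mem_nhds x₀ hr), ?_⟩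
  refine (measure_mono ?_).trans_lt (euclideanHausdorffMeasure_image_lt_top hφ hfin)
  rintro x ⟨hx, hxr⟩
  have hxe := inner_eq_of_mem_frontier hΩ hK.continuous hgraph hx hxr
  have hy : x - (inner ℝ e x : ℝ) • e ∈ W := by
    rw [Submodule.mem_orthogonal_singleton_iff_inner_right, inner_sub_right, inner_smul_right,
      real_inner_self_eq_norm_sq, he]
    simp
  refine ⟨⟨_, hy⟩, ?_, ?_⟩
  · have hle : ‖x - (inner ℝ e x : ℝ) • e‖ ^ 2 ≤ ‖x‖ ^ 2 := by
      rw [norm_sub_sq_real, inner_smul_right, norm_smul, he, real_inner_comm, mul_one,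
        Real.norm_eq_abs, sq_abs]
      nlinarith [sq_nonneg (inner ℝ e x : ℝ), real_inner_comm e x]
    have h1 := (sq_le_sq₀ (norm_nonneg _) (norm_nonneg _)).1 hle
    have h2 : ‖x‖ ≤ ‖x₀‖ + r := by
      have := norm_le_norm_add_norm_sub' x x₀
      rw [mem_ball, dist_eq_norm] at hxr
      linarith
    simpa using h1.trans h2
  · have := hinv x (-(inner ℝ e x : ℝ))
    simp only [φ, sub_eq_add_neg, ← neg_smul, this]
    rw [← hxe]
    simp

end Boundary

section Hilbert

variable {H : Type*} [NormedAddCommGroup H] [InnerProductSpace ℝ H]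

/-- In a Hilbert space, nearly norm-minimal points of a decreasing sequence of bounded
midpoint-convex sets converge. -/
theorem exists_tendsto_of_antitone_midpoint [CompleteSpace H] {C : ℕ → Set H} (hanti : Antitone C)
    (hmid : ∀ k, ∀ x ∈ C k, ∀ y ∈ C k, (1 / 2 : ℝ) • (x + y) ∈ C k)
    (hne : ∀ k, (C k).Nonempty) {R : ℝ} (hR : ∀ x ∈ C 0, ‖x‖ ≤ R) :
    ∃ (s : ℕ → H) (x : H), (∀ k, s k ∈ C k) ∧ Tendsto s atTop (𝓝 x) := by
  let d : ℕ → ℝ := fun k => sInf ((fun x => ‖x‖ ^ 2) '' C k)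
  have hbdd : ∀ k, BddBelow ((fun x => ‖x‖ ^ 2) '' C k) := fun k =>
    ⟨0, by rintro _ ⟨x, -, rfl⟩; positivity⟩
  have hd : ∀ k, ∀ x ∈ C k, d k ≤ ‖x‖ ^ 2 := fun k x hx => csInf_le (hbdd k) ⟨x, hx, rfl⟩
  have hmono : Monotone d := fun j k hjk =>
    csInf_le_csInf (hbdd j) ((hne k).image _) (image_mono (hanti hjk))
  have hdR : BddAbove (range d) := by
    refine ⟨R ^ 2, ?_⟩
    rintro _ ⟨k, rfl⟩
    obtain ⟨x, hx⟩ := hne k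
    exact (hd k x hx).trans (pow_le_pow_left₀ (norm_nonneg _) (hR x (hanti (Nat.zero_le k) hx)) 2)
  have hlim := tendsto_atTop_ciSup hmono hdR
  have hex : ∀ k : ℕ, ∃ x ∈ C k, ‖x‖ ^ 2 < d k + 1 / ((k : ℝ) + 1) := by
    intro k
    obtain ⟨_, ⟨x, hx, rfl⟩, hlt⟩ := exists_lt_of_csInf_lt ((hne k).image _)
      (lt_add_of_pos_right (d k) (Nat.one_div_pos_of_nat (α := ℝ) (n := k)))
    exact ⟨x, hx, hlt⟩
  choose s hs hsd using hex
  have hcau : CauchySeq s := by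
    refine cauchySeq_of_le_tendsto_0
      (fun N => √(4 * ((⨆ k, d k) - d N) + 4 * (1 / ((N : ℝ) + 1)))) ?_ ?_
    · intro n m N hn hm
      refine Real.le_sqrt_of_sq_le ?_
      rw [dist_eq_norm]
      have hpar := parallelogram_law_with_norm ℝ (s n) (s m)
      have hm' := hd N _ (hmid N _ (hanti hn (hs n)) _ (hanti hm (hs m)))
      rw [norm_smul, mul_pow] at hm'
      norm_num at hm'
      have h1 := (hsd n).le
      have h2 := (hsd m).le
      have h3 := le_ciSup hdR n
      have h4 := le_ciSup hdR m
      have h5 := Nat.one_div_le_one_div (α := ℝ) hn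
      have h6 := Nat.one_div_le_one_div (α := ℝ) hm
      nlinarith
    · have h0 : Tendsto (fun N : ℕ => 4 * ((⨆ k, d k) - d N) + 4 * (1 / ((N : ℝ) + 1)))
          atTop (𝓝 (4 * ((⨆ k, d k) - ⨆ k, d k) + 4 * 0)) :=
        ((hlim.const_sub _).const_mul 4).add (tendsto_one_div_add_atTop_nhds_zero_nat.const_mul 4)
      simpa using h0.sqrt
  obtain ⟨x, hx⟩ := cauchySeq_tendsto_of_complete hcau
  exact ⟨s, x, hs, hx⟩

/-- Lax-Milgram. -/
theorem existsUnique_of_isCoercive [CompleteSpace H] {B : H →L[ℝ] H →L[ℝ] ℝ} (hB : IsCoercive B)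
    (ℓ : H →L[ℝ] ℝ) : ∃! u, ∀ v, B u v = ℓ v := by
  refine ⟨hB.continuousLinearEquivOfBilin.symm ((InnerProductSpace.toDual ℝ H).symm ℓ), ?_, ?_⟩
  · intro v
    rw [← hB.continuousLinearEquivOfBilin_apply]
    simp
  · intro u hu
    rw [ContinuousLinearEquiv.eq_symm_apply, eq_comm]
    refine hB.unique_continuousLinearEquivOfBilin fun v => ?_
    simp [hu v]

end Hilbert

section WeightedInner

variable {α F : Type*} [MeasurableSpace α] {μ : Measure α} [NormedAddCommGroup F]
  [InnerProductSpace ℝ F] {a a' : α → ℝ} {C : ℝ}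

/-- `a` is measurable and `|a| ≤ C` almost everywhere. -/
structure EssBounded (μ : Measure α) (a : α → ℝ) (C : ℝ) : Prop where
  aemeasurable : AEMeasurable a μ
  bound : ∀ᵐ x ∂μ, |a x| ≤ C

/-- The weighted inner product `∫ a ⟪u, v⟫`. -/
noncomputable def weightedInner (μ : Measure α) (a : α → ℝ) (u v : Lp F 2 μ) : ℝ :=
  ∫ x, a x * inner ℝ (u x) (v x) ∂μ

theorem EssBounded.memLp_smul (h : EssBounded μ a C) (u : Lp F 2 μ) :
    MemLp (fun x => a x • u x) 2 μ := by
  refine (Lp.memLp u).of_le_mul (c := C)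
    (h.aemeasurable.aestronglyMeasurable.smul (Lp.aestronglyMeasurable u)) ?_
  filter_upwards [h.bound] with x hx
  rw [norm_smul, Real.norm_eq_abs]
  gcongr

theorem EssBounded.integrable (h : EssBounded μ a C) (u v : Lp F 2 μ) :
    Integrable (fun x => a x * inner ℝ (u x) (v x)) μ := by
  refine (L2.integrable_inner (𝕜 := ℝ) ((h.memLp_smul u).toLp _) v).congr ?_
  filter_upwards [(h.memLp_smul u).coeFn_toLp] with x hx
  rw [hx, real_inner_smul_left]

theorem EssBounded.weightedInner_eq (h : EssBounded μ a C) (u v : Lp F 2 μ) :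
    weightedInner μ a u v = inner ℝ ((h.memLp_smul u).toLp _) v := by
  rw [L2.inner_def]
  refine integral_congr_ae ?_
  filter_upwards [(h.memLp_smul u).coeFn_toLp] with x hx
  rw [hx, real_inner_smul_left]

theorem EssBounded.norm_weightedInner_le (h : EssBounded μ a C) (u v : Lp F 2 μ) :
    ‖weightedInner μ a u v‖ ≤ C * ‖u‖ * ‖v‖ := by
  rw [h.weightedInner_eq]
  refine (norm_inner_le_norm _ _).trans ?_
  gcongr
  refine Lp.norm_le_mul_norm_of_ae_le_mul ?_
  filter_upwards [(h.memLp_smul u).coeFn_toLp, h.bound] with x hx hC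
  rw [hx, norm_smul, Real.norm_eq_abs]
  gcongr

theorem weightedInner_comm (u v : Lp F 2 μ) : weightedInner μ a u v = weightedInner μ a v u := by
  simp only [weightedInner, real_inner_comm]

/-- `weightedInner` as a bounded bilinear form. -/
noncomputable def EssBounded.weightedInnerL (h : EssBounded μ a C) :
    Lp F 2 μ →L[ℝ] Lp F 2 μ →L[ℝ] ℝ :=
  LinearMap.mkContinuous₂
    (LinearMap.mk₂ ℝ (weightedInner μ a)
      (fun u u' v => by
        rw [weightedInner_comm, weightedInner_comm u, weightedInner_comm u', h.weightedInner_eq,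
          h.weightedInner_eq, h.weightedInner_eq, inner_add_right])
      (fun c u v => by
        rw [weightedInner_comm, weightedInner_comm u, h.weightedInner_eq,
          h.weightedInner_eq, inner_smul_right, smul_eq_mul])
      (fun u v v' => by
        rw [h.weightedInner_eq, h.weightedInner_eq, h.weightedInner_eq, inner_add_right])
      (fun c u v => by
        rw [h.weightedInner_eq, h.weightedInner_eq, inner_smul_right, smul_eq_mul]))
    C h.norm_weightedInner_le

theorem EssBounded.weightedInner_midpoint (h : EssBounded μ a C) (h' : EssBounded μ a' C)
    (u v : Lp F 2 μ) :
    weightedInner μ (fun x => 1 / 2 * (a x + a' x)) u v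
      = 1 / 2 * (weightedInner μ a u v + weightedInner μ a' u v) := by
  simp only [weightedInner]
  rw [← integral_add (h.integrable u v) (h'.integrable u v), ← integral_const_mul]
  congr 1 with x
  ring

theorem le_weightedInner_self {c : ℝ} (h : EssBounded μ a C) (hc : ∀ᵐ x ∂μ, c ≤ a x)
    (u : Lp F 2 μ) : c * ∫ x, ‖u x‖ ^ 2 ∂μ ≤ weightedInner μ a u u := by
  rw [← integral_const_mul]
  refine integral_mono_ae ((memLp_two_iff_integrable_sq_norm (Lp.aestronglyMeasurable u)).1
    (Lp.memLp u) |>.const_mul c) (h.integrable u u) ?_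
  filter_upwards [hc] with x hx
  simp only [real_inner_self_eq_norm_sq]
  gcongr

theorem weightedInner_self_le {c : ℝ} (h : EssBounded μ a C) (hc : ∀ᵐ x ∂μ, a x ≤ c)
    (u : Lp F 2 μ) : weightedInner μ a u u ≤ c * ∫ x, ‖u x‖ ^ 2 ∂μ := by
  rw [← integral_const_mul]
  refine integral_mono_ae (h.integrable u u)
    ((memLp_two_iff_integrable_sq_norm (Lp.aestronglyMeasurable u)).1
    (Lp.memLp u) |>.const_mul c) ?_
  filter_upwards [hc] with x hx
  simp only [real_inner_self_eq_norm_sq]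
  gcongr

theorem tendsto_weightedInner {s : ℕ → α → ℝ} (h : ∀ n, EssBounded μ (s n) C)
    (ha : ∀ᵐ x ∂μ, Tendsto (fun n => s n x) atTop (𝓝 (a x))) (u v : Lp F 2 μ) :
    Tendsto (fun n => weightedInner μ (s n) u v) atTop (𝓝 (weightedInner μ a u v)) := by
  refine tendsto_integral_of_dominated_convergence (fun x => C * ‖(inner ℝ (u x) (v x) : ℝ)‖)
    (fun n => ((h n).integrable u v).aestronglyMeasurable)
    ((L2.integrable_inner (𝕜 := ℝ) u v).norm.const_mul C) (fun n => ?_) ?_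
  · filter_upwards [(h n).bound] with x hx
    rw [norm_mul, Real.norm_eq_abs]
    gcongr
  · filter_upwards [ha] with x hx
    exact hx.mul_const _

theorem integral_norm_sq_eq (u : Lp F 2 μ) : ∫ x, ‖u x‖ ^ 2 ∂μ = ‖u‖ ^ 2 := by
  rw [← real_inner_self_eq_norm_sq, L2.inner_def]
  simp only [real_inner_self_eq_norm_sq]

end WeightedInner

section Complete

variable {M : ℕ} {Ω : Set (E M)}

theorem isClosed_H1 (Ω : Set (E M)) :
    IsClosed (H1 Ω : Set (WithLp 2 (Lp ℝ 2 (vol Ω) × Lp (E M) 2 (vol Ω)))) := by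
  have : (H1 Ω : Set (WithLp 2 (Lp ℝ 2 (vol Ω) × Lp (E M) 2 (vol Ω)))) =
      ⋂ (ψ : E M → ℝ) (_ : ContDiff ℝ ∞ ψ) (_ : HasCompactSupport ψ) (_ : tsupport ψ ⊆ Ω),
        {p | ∫ x in Ω, p.fst x • gradient ψ x = - ∫ x in Ω, ψ x • p.snd x} := by
    ext p
    simp only [mem_iInter]
    rfl
  rw [this]
  refine isClosed_iInter fun ψ => isClosed_iInter fun hψ => isClosed_iInter fun hc =>
    isClosed_iInter fun _ => ?_
  have hc' : HasCompactSupport (gradient ψ) :=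
    (hc.fderiv (𝕜 := ℝ)).comp_left (g := (InnerProductSpace.toDual ℝ (E M)).symm) (by simp)
  have hg : MemLp (gradient ψ) 2 (vol Ω) := (continuous_gradient hψ).memLp_of_hasCompactSupport hc'
  have hp : MemLp ψ 2 (vol Ω) := hψ.continuous.memLp_of_hasCompactSupport hc
  let B := ContinuousLinearMap.lpPairing (vol Ω) 2 2 (ContinuousLinearMap.lsmul ℝ ℝ (E := E M))
  have h1 : ∀ v : Lp ℝ 2 (vol Ω), ∫ x in Ω, v x • gradient ψ x = B v (hg.toLp _) := by
    intro v
    rw [ContinuousLinearMap.lpPairing_eq_integral]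
    refine integral_congr_ae ?_
    filter_upwards [hg.coeFn_toLp] with x hx
    simp [hx]
  have h2 : ∀ g : Lp (E M) 2 (vol Ω), ∫ x in Ω, ψ x • g x = B (hp.toLp _) g := by
    intro g
    rw [ContinuousLinearMap.lpPairing_eq_integral]
    refine integral_congr_ae ?_
    filter_upwards [hp.coeFn_toLp] with x hx
    simp [hx]
  simp only [h1, h2]
  refine isClosed_eq ?_ ?_
  · exact ((ContinuousLinearMap.flip B (hg.toLp _)).comp (WithLp.fstL 2 ℝ _ _)).continuous
  · exact ((B (hp.toLp _)).comp (WithLp.sndL 2 ℝ _ _)).continuous.neg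

instance : CompleteSpace (H1 Ω) := (isClosed_H1 Ω).completeSpace_coe

/-- `fn` as a bounded linear map. -/
noncomputable def fnL (Ω : Set (E M)) : H1 Ω →L[ℝ] Lp ℝ 2 (vol Ω) :=
  (WithLp.fstL 2 ℝ _ _).comp (H1 Ω).subtypeL

/-- `grad` as a bounded linear map. -/
noncomputable def gradL (Ω : Set (E M)) : H1 Ω →L[ℝ] Lp (E M) 2 (vol Ω) :=
  (WithLp.sndL 2 ℝ _ _).comp (H1 Ω).subtypeL

theorem norm_sq_H1 (v : H1 Ω) : ‖v‖ ^ 2 = ‖fn v‖ ^ 2 + ‖grad v‖ ^ 2 :=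
  WithLp.prod_norm_sq_eq_of_L2 v.1

theorem norm_fn_le (v : H1 Ω) : ‖fn v‖ ≤ ‖v‖ :=
  (sq_le_sq₀ (norm_nonneg _) (norm_nonneg _)).1
    (by rw [norm_sq_H1]; exact le_add_of_nonneg_right (sq_nonneg _))

theorem norm_grad_le (v : H1 Ω) : ‖grad v‖ ≤ ‖v‖ :=
  (sq_le_sq₀ (norm_nonneg _) (norm_nonneg _)).1
    (by rw [norm_sq_H1]; exact le_add_of_nonneg_left (sq_nonneg _))

end Complete

/-- The assumptions on the domains, the constants and the data. -/
structure TikhonovData {M : ℕ} (Ω Ω₁ : Set (E M)) (γ aLow aUp bUp CF ρ : ℝ)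
    (b f aStar : E M → ℝ) : Prop where
  finite_vol : IsFiniteMeasure (vol Ω)
  finite_surf : IsFiniteMeasure (surf Ω₁)
  subset : Ω₁ ⊆ Ω
  gamma_pos : 0 < γ
  aLow_pos : 0 < aLow
  aLow_lt : aLow < aUp
  CF_pos : 0 < CF
  friedrichs : IsFriedrichsConstant Ω₁ CF
  bUp_pos : 0 < bUp
  bUp_lt : bUp < aLow * min 1 γ / CF
  rho_pos : 0 < ρ
  b_aemeasurable : AEMeasurable b (vol Ω)
  b_bound : ∀ᵐ x ∂(vol Ω), 0 < b x ∧ b x < bUp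
  f_memLp : MemLp f ⊤ (vol Ω)
  aStar_memLp : MemLp aStar 2 (vol Ω)

theorem real_inner_eq_mul (x y : ℝ) : inner ℝ x y = x * y := by simp [mul_comm]

theorem form_eq {M : ℕ} {Ω₁ : Set (E M)} (γ : ℝ) (b a : E M → ℝ) (u v : H1 Ω₁) :
    form Ω₁ γ b a u v = weightedInner (vol Ω₁) a (grad u) (grad v)
      + weightedInner (surf Ω₁) (fun x => a x * γ) (trace Ω₁ u) (trace Ω₁ v)
      - weightedInner (vol Ω₁) b (fn u) (fn v) := by
  simp only [form, weightedInner, real_inner_eq_mul]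

theorem form_comm {M : ℕ} {Ω₁ : Set (E M)} (γ : ℝ) (b a : E M → ℝ) (u v : H1 Ω₁) :
    form Ω₁ γ b a u v = form Ω₁ γ b a v u := by
  simp only [form_eq, weightedInner_comm]

/-- For fixed `a`, the Tikhonov functional is the maximum over `v` of these functionals, which for
fixed `v` depend on `a` in an elementary way. -/
noncomputable def dualFunctional {M : ℕ} (Ω Ω₁ : Set (E M)) (γ ρ : ℝ)
    (b f aStar : E M → ℝ) (z v : H1 Ω₁) (a : E M → ℝ) : ℝ :=
  (∫ x in Ω₁, f x * fn v x) - 1 / 2 * form Ω₁ γ b a v v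
    - (∫ x in Ω₁, f x * fn z x) + 1 / 2 * form Ω₁ γ b a z z
    + ρ * ∫ x in Ω, (a x - aStar x) ^ 2

theorem midpoint_mem_admissible {M : ℕ} {Ω Ω₁ : Set (E M)} {aLow aUp : ℝ} {a a' : E M → ℝ}
    (ha : a ∈ admissible Ω Ω₁ aLow aUp)
    (ha' : a' ∈ admissible Ω Ω₁ aLow aUp) :
    (fun x => 1 / 2 * (a x + a' x)) ∈ admissible Ω Ω₁ aLow aUp := by
  refine ⟨(ha.1.add ha'.1).const_mul _, (ha.2.1.add ha'.2.1).const_mul _, ?_, ?_⟩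
  · filter_upwards [ha.2.2.1, ha'.2.2.1] with x h1 h2
    constructor <;> linarith [h1.1, h1.2, h2.1, h2.2]
  · filter_upwards [ha.2.2.2, ha'.2.2.2] with x h1 h2
    constructor <;> linarith [h1.1, h1.2, h2.1, h2.2]

namespace TikhonovData

variable {M : ℕ} {Ω Ω₁ : Set (E M)} {γ aLow aUp bUp CF ρ : ℝ} {b f aStar a a' : E M → ℝ}
  (D : TikhonovData Ω Ω₁ γ aLow aUp bUp CF ρ b f aStar)

include D

theorem aUp_pos : 0 < aUp := D.aLow_pos.trans D.aLow_lt

theorem vol_le : vol Ω₁ ≤ vol Ω := Measure.restrict_mono D.subset le_rfl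

theorem ae_bounds_vol (ha : a ∈ admissible Ω Ω₁ aLow aUp) :
    ∀ᵐ x ∂(vol Ω₁), aLow ≤ a x ∧ a x ≤ aUp :=
  ae_mono D.vol_le ha.2.2.1

theorem essBounded_vol_outer (ha : a ∈ admissible Ω Ω₁ aLow aUp) : EssBounded (vol Ω) a aUp := by
  refine ⟨ha.1, ?_⟩
  filter_upwards [ha.2.2.1] with x hx
  rw [abs_of_nonneg (D.aLow_pos.le.trans hx.1)]
  exact hx.2

theorem essBounded_vol (ha : a ∈ admissible Ω Ω₁ aLow aUp) : EssBounded (vol Ω₁) a aUp :=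
  ⟨ha.1.mono_measure D.vol_le, ae_mono D.vol_le (D.essBounded_vol_outer ha).bound⟩

theorem essBounded_surf (ha : a ∈ admissible Ω Ω₁ aLow aUp) :
    EssBounded (surf Ω₁) (fun x => a x * γ) (aUp * γ) := by
  refine ⟨ha.2.1.mul_const γ, ?_⟩
  filter_upwards [ha.2.2.2] with x hx
  rw [abs_of_nonneg (mul_nonneg (D.aLow_pos.le.trans hx.1) D.gamma_pos.le)]
  exact mul_le_mul_of_nonneg_right hx.2 D.gamma_pos.le

theorem ae_bounds_b : ∀ᵐ x ∂(vol Ω₁), 0 < b x ∧ b x < bUp := ae_mono D.vol_le D.b_bound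

theorem essBounded_b : EssBounded (vol Ω₁) b bUp := by
  refine ⟨D.b_aemeasurable.mono_measure D.vol_le, ?_⟩
  filter_upwards [D.ae_bounds_b] with x hx
  rw [abs_of_nonneg hx.1.le]
  exact hx.2.le

/-- `form` as a bounded bilinear form. -/
theorem exists_formL (ha : a ∈ admissible Ω Ω₁ aLow aUp) :
    ∃ B : H1 Ω₁ →L[ℝ] H1 Ω₁ →L[ℝ] ℝ, ∀ u v, form Ω₁ γ b a u v = B u v :=
  ⟨(D.essBounded_vol ha).weightedInnerL.bilinearComp (gradL Ω₁) (gradL Ω₁)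
    + (D.essBounded_surf ha).weightedInnerL.bilinearComp (trace Ω₁) (trace Ω₁)
    - D.essBounded_b.weightedInnerL.bilinearComp (fnL Ω₁) (fnL Ω₁),
    fun u v => by rw [form_eq]; rfl⟩

theorem norm_form_le (ha : a ∈ admissible Ω Ω₁ aLow aUp) (u v : H1 Ω₁) :
    ‖form Ω₁ γ b a u v‖ ≤ (aUp + aUp * γ * ‖trace Ω₁‖ ^ 2 + bUp) * (‖u‖ * ‖v‖) := by
  have h0 := D.aUp_pos.le
  have hγ := D.gamma_pos.le
  have hb := D.bUp_pos.le
  have h1 := (D.essBounded_vol ha).norm_weightedInner_le (grad u) (grad v)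
  have h2 := (D.essBounded_surf ha).norm_weightedInner_le (trace Ω₁ u) (trace Ω₁ v)
  have h3 := D.essBounded_b.norm_weightedInner_le (fn u) (fn v)
  rw [form_eq]
  refine (norm_sub_le _ _).trans ((add_le_add_left (norm_add_le _ _) _).trans ?_)
  have h1' : aUp * ‖grad u‖ * ‖grad v‖ ≤ aUp * ‖u‖ * ‖v‖ := by
    gcongr <;> exact norm_grad_le _
  have h2' : aUp * γ * ‖trace Ω₁ u‖ * ‖trace Ω₁ v‖
      ≤ aUp * γ * (‖trace Ω₁‖ * ‖u‖) * (‖trace Ω₁‖ * ‖v‖) := by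
    gcongr <;> exact ContinuousLinearMap.le_opNorm _ _
  have h3' : bUp * ‖fn u‖ * ‖fn v‖ ≤ bUp * ‖u‖ * ‖v‖ := by
    gcongr <;> exact norm_fn_le _
  linarith

theorem coercivity_pos : 0 < aLow * min 1 γ / CF - bUp := sub_pos.2 D.bUp_lt

theorem le_form_self (ha : a ∈ admissible Ω Ω₁ aLow aUp) (v : H1 Ω₁) :
    (aLow * min 1 γ / CF - bUp) * ‖v‖ ^ 2 ≤ form Ω₁ γ b a v v := by
  have h1 := le_weightedInner_self (D.essBounded_vol ha)
    ((D.ae_bounds_vol ha).mono fun x hx => hx.1) (grad v)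
  have h2 := le_weightedInner_self (c := aLow * γ) (D.essBounded_surf ha)
    (ha.2.2.2.mono fun x hx => mul_le_mul_of_nonneg_right hx.1 D.gamma_pos.le) (trace Ω₁ v)
  have h3 := weightedInner_self_le D.essBounded_b (D.ae_bounds_b.mono fun x hx => hx.2.le) (fn v)
  have hF := D.friedrichs v
  have hsq : ∫ x, (trace Ω₁ v x) ^ 2 ∂(surf Ω₁) = ‖trace Ω₁ v‖ ^ 2 := by
    rw [← integral_norm_sq_eq]; simp
  rw [integral_norm_sq_eq] at h1 h2 h3
  rw [integral_norm_sq_eq, hsq] at hF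
  rw [form_eq]
  have hm1 : aLow * min 1 γ * ‖grad v‖ ^ 2 ≤ aLow * ‖grad v‖ ^ 2 := by
    gcongr
    exact mul_le_of_le_one_right D.aLow_pos.le (min_le_left _ _)
  have hm2 : aLow * min 1 γ * ‖trace Ω₁ v‖ ^ 2 ≤ aLow * γ * ‖trace Ω₁ v‖ ^ 2 := by
    have := D.aLow_pos.le
    gcongr
    exact min_le_right _ _
  have hm3 : bUp * ‖fn v‖ ^ 2 ≤ bUp * ‖v‖ ^ 2 := by
    have := D.bUp_pos.le
    gcongr
    exact norm_fn_le v
  have hm4 : aLow * min 1 γ / CF * ‖v‖ ^ 2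
      ≤ aLow * min 1 γ * (‖grad v‖ ^ 2 + ‖trace Ω₁ v‖ ^ 2) := by
    rw [div_mul_eq_mul_div, div_le_iff₀ D.CF_pos, mul_assoc _ _ CF, mul_comm _ CF]
    have := D.aLow_pos.le
    have := D.gamma_pos.le
    gcongr
  linarith

theorem form_self_nonneg (ha : a ∈ admissible Ω Ω₁ aLow aUp) (v : H1 Ω₁) :
    0 ≤ form Ω₁ γ b a v v :=
  (mul_nonneg D.coercivity_pos.le (sq_nonneg _)).trans (D.le_form_self ha v)

theorem form_sub_sub (ha : a ∈ admissible Ω Ω₁ aLow aUp) (u v : H1 Ω₁) :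
    form Ω₁ γ b a (u - v) (u - v)
      = form Ω₁ γ b a u u - 2 * form Ω₁ γ b a u v + form Ω₁ γ b a v v := by
  have hc := form_comm γ b a u v
  obtain ⟨B, hB⟩ := D.exists_formL ha
  simp only [hB, map_sub, sub_apply] at hc ⊢
  linarith

theorem form_self_sub_form_self (ha : a ∈ admissible Ω Ω₁ aLow aUp) (u v : H1 Ω₁) :
    form Ω₁ γ b a u u - form Ω₁ γ b a v v = form Ω₁ γ b a (u - v) (u + v) := by
  have hc := form_comm γ b a u v
  obtain ⟨B, hB⟩ := D.exists_formL ha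
  simp only [hB, map_sub, map_add, sub_apply] at hc ⊢
  linarith

theorem exists_load : ∃ ℓ : H1 Ω₁ →L[ℝ] ℝ, ∀ v, ∫ x in Ω₁, f x * fn v x = ℓ v := by
  have := D.finite_vol
  have hf : MemLp f 2 (vol Ω₁) := (D.f_memLp.mono_exponent le_top).mono_measure D.vol_le
  refine ⟨(innerSL ℝ (hf.toLp f)).comp (fnL Ω₁), fun v => ?_⟩
  change _ = inner ℝ (hf.toLp f) (fn v)
  rw [L2.inner_def]
  refine integral_congr_ae ?_
  filter_upwards [hf.coeFn_toLp] with x hx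
  simp [hx, mul_comm]

theorem existsUnique_isWeakSolution (ha : a ∈ admissible Ω Ω₁ aLow aUp) :
    ∃! u, IsWeakSolution Ω₁ γ b f a u := by
  obtain ⟨B, hB⟩ := D.exists_formL ha
  obtain ⟨ℓ, hℓ⟩ := D.exists_load
  have hco : IsCoercive B := by
    refine ⟨_, D.coercivity_pos, fun v => ?_⟩
    rw [mul_assoc, ← sq, ← hB]
    exact D.le_form_self ha v
  simpa only [IsWeakSolution, hB, hℓ] using existsUnique_of_isCoercive hco ℓ

theorem isWeakSolution_U (ha : a ∈ admissible Ω Ω₁ aLow aUp) :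
    IsWeakSolution Ω₁ γ b f a (U Ω₁ γ b f a) := by
  have h := (D.existsUnique_isWeakSolution ha).exists
  rw [U, dif_pos h]
  exact h.choose_spec

theorem memLp_sub_aStar (ha : a ∈ admissible Ω Ω₁ aLow aUp) :
    MemLp (fun x => a x - aStar x) 2 (vol Ω) := by
  have := D.finite_vol
  exact (MemLp.of_bound ha.1.aestronglyMeasurable aUp (D.essBounded_vol_outer ha).bound).sub
    D.aStar_memLp

theorem tikhonov_eq (ha : a ∈ admissible Ω Ω₁ aLow aUp) (z : H1 Ω₁) :
    tikhonov Ω Ω₁ γ ρ b f aStar z a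
      = dualFunctional Ω Ω₁ γ ρ b f aStar z (U Ω₁ γ b f a) a := by
  have h := D.isWeakSolution_U ha
  have h1 := h z
  have h2 := h (U Ω₁ γ b f a)
  rw [tikhonov, dualFunctional, D.form_sub_sub ha]
  linarith

theorem dualFunctional_le (ha : a ∈ admissible Ω Ω₁ aLow aUp) (z v : H1 Ω₁) :
    dualFunctional Ω Ω₁ γ ρ b f aStar z v a ≤ tikhonov Ω Ω₁ γ ρ b f aStar z a := by
  have h := D.isWeakSolution_U ha
  have h1 := h v
  have h2 := h (U Ω₁ γ b f a)
  have h3 := D.form_self_nonneg ha (U Ω₁ γ b f a - v)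
  rw [D.form_sub_sub ha] at h3
  rw [D.tikhonov_eq ha, dualFunctional, dualFunctional]
  linarith

theorem tikhonov_nonneg (ha : a ∈ admissible Ω Ω₁ aLow aUp) (z : H1 Ω₁) :
    0 ≤ tikhonov Ω Ω₁ γ ρ b f aStar z a :=
  add_nonneg (mul_nonneg (by norm_num) (D.form_self_nonneg ha _))
    (mul_nonneg D.rho_pos.le (integral_nonneg fun _ => sq_nonneg _))

theorem form_midpoint (ha : a ∈ admissible Ω Ω₁ aLow aUp) (ha' : a' ∈ admissible Ω Ω₁ aLow aUp)
    (u v : H1 Ω₁) :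
    form Ω₁ γ b (fun x => 1 / 2 * (a x + a' x)) u v
      = 1 / 2 * (form Ω₁ γ b a u v + form Ω₁ γ b a' u v) := by
  have h2 := (D.essBounded_surf ha).weightedInner_midpoint (D.essBounded_surf ha')
    (trace Ω₁ u) (trace Ω₁ v)
  simp only [← add_mul, ← mul_assoc] at h2
  simp only [form_eq]
  rw [(D.essBounded_vol ha).weightedInner_midpoint (D.essBounded_vol ha'), h2]
  ring

theorem integral_midpoint_sub_sq (ha : a ∈ admissible Ω Ω₁ aLow aUp)
    (ha' : a' ∈ admissible Ω Ω₁ aLow aUp) :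
    ∫ x in Ω, (1 / 2 * (a x + a' x) - aStar x) ^ 2
      = 1 / 2 * (∫ x in Ω, (a x - aStar x) ^ 2) + 1 / 2 * (∫ x in Ω, (a' x - aStar x) ^ 2)
        - 1 / 4 * ∫ x in Ω, (a x - a' x) ^ 2 := by
  have h1 := (D.memLp_sub_aStar ha).integrable_sq
  have h2 := (D.memLp_sub_aStar ha').integrable_sq
  have h3 : Integrable (fun x => (a x - a' x) ^ 2) (vol Ω) := by
    refine ((D.memLp_sub_aStar ha).sub (D.memLp_sub_aStar ha')).integrable_sq.congr
      (Eventually.of_forall fun x => ?_)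
    simp
  have h12 : Integrable (fun x => 1 / 2 * (a x - aStar x) ^ 2 + 1 / 2 * (a' x - aStar x) ^ 2)
      (vol Ω) := (h1.const_mul _).add (h2.const_mul _)
  rw [← integral_const_mul, ← integral_const_mul, ← integral_const_mul,
    ← integral_add (h1.const_mul _) (h2.const_mul _), ← integral_sub h12 (h3.const_mul _)]
  congr 1 with x
  ring

/-- Strong midpoint convexity of the Tikhonov functional. -/
theorem tikhonov_midpoint_le (ha : a ∈ admissible Ω Ω₁ aLow aUp)
    (ha' : a' ∈ admissible Ω Ω₁ aLow aUp)
    (hm : (fun x => 1 / 2 * (a x + a' x)) ∈ admissible Ω Ω₁ aLow aUp) (z : H1 Ω₁) :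
    tikhonov Ω Ω₁ γ ρ b f aStar z (fun x => 1 / 2 * (a x + a' x))
        + ρ / 4 * ∫ x in Ω, (a x - a' x) ^ 2
      ≤ 1 / 2 * (tikhonov Ω Ω₁ γ ρ b f aStar z a + tikhonov Ω Ω₁ γ ρ b f aStar z a') := by
  set v := U Ω₁ γ b f (fun x => 1 / 2 * (a x + a' x)) with hv
  have h1 := D.dualFunctional_le ha z v
  have h2 := D.dualFunctional_le ha' z v
  rw [D.tikhonov_eq hm, ← hv]
  simp only [dualFunctional] at h1 h2 ⊢
  rw [D.form_midpoint ha ha', D.form_midpoint ha ha', D.integral_midpoint_sub_sq ha ha']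
  linarith

/-- Quadratic growth of the Tikhonov functional at a minimizer. -/
theorem add_integral_sq_le_of_isMinOn {A : Set (E M → ℝ)} (hA : A ⊆ admissible Ω Ω₁ aLow aUp)
    (hconv : Convex ℝ A) (ha : a ∈ A) (ha' : a' ∈ A) {z : H1 Ω₁}
    (hmin : IsMinOn (tikhonov Ω Ω₁ γ ρ b f aStar z) A a) :
    tikhonov Ω Ω₁ γ ρ b f aStar z a + ρ / 2 * ∫ x in Ω, (a x - a' x) ^ 2
      ≤ tikhonov Ω Ω₁ γ ρ b f aStar z a' := by
  have hm : (fun x => 1 / 2 * (a x + a' x)) ∈ A := by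
    have := hconv ha ha' (a := 1 / 2) (b := 1 / 2) (by norm_num) (by norm_num) (by norm_num)
    convert this using 1
    ext x
    simp [mul_add]
  have h1 := D.tikhonov_midpoint_le (hA ha) (hA ha') (hA hm) z
  have h2 := isMinOn_iff.1 hmin _ hm
  linarith

theorem abs_tikhonov_sub_sub_le (ℓ : H1 Ω₁ →L[ℝ] ℝ)
    (hℓ : ∀ v, ∫ x in Ω₁, f x * fn v x = ℓ v) (ha : a ∈ admissible Ω Ω₁ aLow aUp) (z z' : H1 Ω₁) :
    |tikhonov Ω Ω₁ γ ρ b f aStar z a - tikhonov Ω Ω₁ γ ρ b f aStar z' a|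
      ≤ ‖ℓ (z - z')‖
        + 1 / 2 * ((aUp + aUp * γ * ‖trace Ω₁‖ ^ 2 + bUp) * (‖z - z'‖ * ‖z + z'‖)) := by
  have h1 := D.norm_form_le ha (z - z') (z + z')
  rw [← D.form_self_sub_form_self ha] at h1
  rw [D.tikhonov_eq ha, D.tikhonov_eq ha]
  simp only [dualFunctional, hℓ, map_sub]
  rw [Real.norm_eq_abs, abs_le] at h1
  rw [Real.norm_eq_abs, abs_le]
  have h2 := le_abs_self (ℓ z - ℓ z')
  have h3 := neg_abs_le (ℓ z - ℓ z')
  constructor <;> linarith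

theorem tendsto_dualFunctional {s : ℕ → E M → ℝ} (hs : ∀ n, s n ∈ admissible Ω Ω₁ aLow aUp)
    (hvol : ∀ᵐ x ∂(vol Ω), Tendsto (fun n => s n x) atTop (𝓝 (a x)))
    (hsurf : ∀ᵐ x ∂(surf Ω₁), Tendsto (fun n => s n x) atTop (𝓝 (a x))) (z v : H1 Ω₁) :
    Tendsto (fun n => dualFunctional Ω Ω₁ γ ρ b f aStar z v (s n)) atTop
      (𝓝 (dualFunctional Ω Ω₁ γ ρ b f aStar z v a)) := by
  have := D.finite_vol
  have hform : ∀ u : H1 Ω₁,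
      Tendsto (fun n => form Ω₁ γ b (s n) u u) atTop (𝓝 (form Ω₁ γ b a u u)) := by
    intro u
    simp only [form_eq]
    exact ((tendsto_weightedInner (fun n => D.essBounded_vol (hs n)) (ae_mono D.vol_le hvol)
      _ _).add (tendsto_weightedInner (fun n => D.essBounded_surf (hs n))
        (hsurf.mono fun x hx => hx.mul_const γ) _ _)).sub_const _
  have hsq : Tendsto (fun n => ∫ x in Ω, (s n x - aStar x) ^ 2) atTop
      (𝓝 (∫ x in Ω, (a x - aStar x) ^ 2)) := by
    have hg : MemLp (fun x => aUp + |aStar x|) 2 (vol Ω) :=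
      (memLp_const aUp).add D.aStar_memLp.abs
    refine tendsto_integral_of_dominated_convergence (fun x => (aUp + |aStar x|) ^ 2)
      (fun n => (D.memLp_sub_aStar (hs n)).integrable_sq.aestronglyMeasurable)
      hg.integrable_sq (fun n => ?_) ?_
    · filter_upwards [(D.essBounded_vol_outer (hs n)).bound] with x hx
      rw [norm_pow, Real.norm_eq_abs]
      gcongr
      exact (abs_sub _ _).trans (by gcongr)
    · filter_upwards [hvol] with x hx
      exact (hx.sub_const _).pow 2
  exact ((((hform v).const_mul _).const_sub _).sub_const _ |>.add ((hform z).const_mul _)).add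
    (hsq.const_mul ρ)

theorem const_mem_admissible : (fun _ => aLow) ∈ admissible Ω Ω₁ aLow aUp :=
  ⟨aemeasurable_const, aemeasurable_const, Eventually.of_forall fun _ => ⟨le_rfl, D.aLow_lt.le⟩,
    Eventually.of_forall fun _ => ⟨le_rfl, D.aLow_lt.le⟩⟩

/-- The Tikhonov functional has a minimizer. The values of a coefficient in the domain and on the
boundary are controlled together, in `L²` of the sum of volume and surface measure. -/
theorem exists_isMinOn (z : H1 Ω₁) :
    ∃ a ∈ admissible Ω Ω₁ aLow aUp,
      IsMinOn (tikhonov Ω Ω₁ γ ρ b f aStar z) (admissible Ω Ω₁ aLow aUp) a := by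
  have := D.finite_vol
  have := D.finite_surf
  set J := tikhonov Ω Ω₁ γ ρ b f aStar z with hJ
  set 𝔸 := admissible Ω Ω₁ aLow aUp with h𝔸
  let ν : Measure (E M) := vol Ω + surf Ω₁
  have haem : ∀ a ∈ 𝔸, AEMeasurable a ν := fun a ha => aemeasurable_add_measure_iff.2 ⟨ha.1, ha.2.1⟩
  have hbd : ∀ a ∈ 𝔸, ∀ᵐ x ∂ν, aLow ≤ a x ∧ a x ≤ aUp := fun a ha =>
    ae_add_measure_iff.2 ⟨ha.2.2.1, ha.2.2.2⟩
  have hbdd : BddBelow (J '' 𝔸) := ⟨0, by rintro _ ⟨a, ha, rfl⟩; exact D.tikhonov_nonneg ha z⟩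
  set m := sInf (J '' 𝔸) with hm
  let C : ℕ → Set (Lp ℝ 2 ν) := fun k => {α | ∃ a ∈ 𝔸, α =ᵐ[ν] a ∧ J a ≤ m + 1 / ((k : ℝ) + 1)}
  have hanti : Antitone C := by
    rintro j k hjk α ⟨a, ha, hαa, hle⟩
    exact ⟨a, ha, hαa, hle.trans (by gcongr)⟩
  have hmid : ∀ k, ∀ α ∈ C k, ∀ β ∈ C k, (1 / 2 : ℝ) • (α + β) ∈ C k := by
    rintro k α ⟨a, ha, hαa, hJa⟩ β ⟨a', ha', hβa', hJa'⟩
    refine ⟨fun x => 1 / 2 * (a x + a' x), midpoint_mem_admissible ha ha', ?_, ?_⟩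
    · filter_upwards [Lp.coeFn_smul (1 / 2 : ℝ) (α + β), Lp.coeFn_add α β, hαa, hβa']
        with x h1 h2 h3 h4
      rw [h1, Pi.smul_apply, h2, Pi.add_apply, h3, h4, smul_eq_mul]
    · have h1 := D.tikhonov_midpoint_le ha ha' (midpoint_mem_admissible ha ha') z
      have h2 : 0 ≤ ρ / 4 * ∫ x in Ω, (a x - a' x) ^ 2 :=
        mul_nonneg (by linarith [D.rho_pos]) (integral_nonneg fun _ => sq_nonneg _)
      linarith
  have hne : ∀ k, (C k).Nonempty := by
    intro k
    obtain ⟨_, ⟨a, ha, rfl⟩, hlt⟩ := exists_lt_of_csInf_lt (s := J '' 𝔸)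
      ⟨_, _, D.const_mem_admissible, rfl⟩
      (lt_add_of_pos_right m (Nat.one_div_pos_of_nat (α := ℝ) (n := k)))
    have hmem : MemLp a 2 ν := by
      refine MemLp.of_bound (haem a ha).aestronglyMeasurable aUp ?_
      filter_upwards [hbd a ha] with x hx
      rw [Real.norm_eq_abs, abs_of_nonneg (D.aLow_pos.le.trans hx.1)]
      exact hx.2
    exact ⟨hmem.toLp a, a, ha, hmem.coeFn_toLp, hlt.le⟩
  obtain ⟨R, hR⟩ : ∃ R, ∀ α ∈ C 0, ‖α‖ ≤ R := by
    refine ⟨_, fun α ⟨a, ha, hαa, _⟩ => Lp.norm_le_of_ae_bound D.aUp_pos.le ?_⟩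
    filter_upwards [hαa, hbd a ha] with x h1 hx
    rw [h1, Real.norm_eq_abs, abs_of_nonneg (D.aLow_pos.le.trans hx.1)]
    exact hx.2
  obtain ⟨σ, α, hσ, hlim⟩ := exists_tendsto_of_antitone_midpoint hanti hmid hne hR
  choose s hs hσs hJs using hσ
  obtain ⟨φ, hφ, hae⟩ := (tendstoInMeasure_of_tendsto_Lp hlim).exists_seq_tendsto_ae
  have hsα : ∀ᵐ x ∂ν, Tendsto (fun n => s (φ n) x) atTop (𝓝 (α x)) := by
    filter_upwards [hae, ae_all_iff.2 hσs] with x hx hσx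
    simpa only [hσx] using hx
  have hαbd : ∀ᵐ x ∂ν, aLow ≤ α x ∧ α x ≤ aUp := by
    filter_upwards [hsα, ae_all_iff.2 fun n => hbd _ (hs (φ n))] with x hx hb
    exact ⟨ge_of_tendsto' hx fun n => (hb n).1, le_of_tendsto' hx fun n => (hb n).2⟩
  have hαmeas : AEMeasurable α ν := (Lp.aestronglyMeasurable α).aemeasurable
  have hα : (α : E M → ℝ) ∈ 𝔸 :=
    ⟨(aemeasurable_add_measure_iff.1 hαmeas).1, (aemeasurable_add_measure_iff.1 hαmeas).2,
      (ae_add_measure_iff.1 hαbd).1, (ae_add_measure_iff.1 hαbd).2⟩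
  have hle : J α ≤ m := by
    rw [hJ, D.tikhonov_eq hα]
    have h1 := D.tendsto_dualFunctional (fun n => hs (φ n)) (ae_add_measure_iff.1 hsα).1
      (ae_add_measure_iff.1 hsα).2 z (U Ω₁ γ b f α)
    have h2 : Tendsto (fun n : ℕ => m + 1 / ((φ n : ℝ) + 1)) atTop (𝓝 (m + 0)) :=
      (tendsto_one_div_add_atTop_nhds_zero_nat.comp hφ.tendsto_atTop).const_add m
    rw [add_zero] at h2
    exact le_of_tendsto_of_tendsto' h1 h2 fun n => (D.dualFunctional_le (hs _) _ _).trans (hJs _)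
  exact ⟨α, hα, isMinOn_iff.2 fun a ha => hle.trans (csInf_le hbdd ⟨a, ha, rfl⟩)⟩

/-- Minimizers over a convex set depend continuously on the data `z`. -/
theorem tendsto_of_isMinOn {A : Set (E M → ℝ)} (hA : A ⊆ admissible Ω Ω₁ aLow aUp)
    (hconv : Convex ℝ A) {z : ℕ → H1 Ω₁} {z₀ : H1 Ω₁} (hz : Tendsto z atTop (𝓝 z₀))
    {s : ℕ → E M → ℝ} (hs : ∀ n, s n ∈ A)
    (hsmin : ∀ n, IsMinOn (tikhonov Ω Ω₁ γ ρ b f aStar (z n)) A (s n)) (ha : a ∈ A)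
    (hamin : IsMinOn (tikhonov Ω Ω₁ γ ρ b f aStar z₀) A a) :
    Tendsto (fun n => eLpNorm (s n - a) 2 (vol Ω)) atTop (𝓝 0) := by
  obtain ⟨ℓ, hℓ⟩ := D.exists_load
  let c := aUp + aUp * γ * ‖trace Ω₁‖ ^ 2 + bUp
  let ε : ℕ → ℝ := fun n =>
    2 / ρ * (‖ℓ (z n - z₀)‖ + 1 / 2 * (c * (‖z n - z₀‖ * ‖z n + z₀‖)))
  have hle : ∀ n, ∫ x in Ω, (s n x - a x) ^ 2 ≤ ε n := by
    intro n
    have h1 := D.add_integral_sq_le_of_isMinOn hA hconv (hs n) ha (hsmin n)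
    have h2 := D.add_integral_sq_le_of_isMinOn hA hconv ha (hs n) hamin
    have h3 := abs_le.1 (D.abs_tikhonov_sub_sub_le ℓ hℓ (hA (hs n)) (z n) z₀)
    have h4 := abs_le.1 (D.abs_tikhonov_sub_sub_le ℓ hℓ (hA ha) (z n) z₀)
    have h5 : ∫ x in Ω, (a x - s n x) ^ 2 = ∫ x in Ω, (s n x - a x) ^ 2 := by
      congr 1 with x
      ring
    rw [h5] at h2
    have hρ := D.rho_pos
    simp only [ε, c]
    rw [div_mul_eq_mul_div, le_div_iff₀ hρ]
    linarith [h3.1, h4.2]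
  have hε : Tendsto ε atTop (𝓝 0) := by
    have hd : Tendsto (fun n => z n - z₀) atTop (𝓝 0) := by simpa using hz.sub_const z₀
    have h1 : Tendsto (fun n => ‖ℓ (z n - z₀)‖) atTop (𝓝 0) := by
      simpa using ((ℓ.continuous.tendsto 0).comp hd).norm
    have h2 : Tendsto (fun n => ‖z n - z₀‖ * ‖z n + z₀‖) atTop (𝓝 0) := by
      simpa using hd.norm.mul (hz.add_const z₀).norm
    have h3 := (h1.add ((h2.const_mul c).const_mul (1 / 2))).const_mul (2 / ρ)
    rwa [mul_zero, mul_zero, add_zero, mul_zero] at h3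
  have heq : ∀ n, eLpNorm (s n - a) 2 (vol Ω) = ENNReal.ofReal (√(∫ x in Ω, (s n x - a x) ^ 2)) := by
    intro n
    have hmem : MemLp (s n - a) 2 (vol Ω) := by
      refine ((D.memLp_sub_aStar (hA (hs n))).sub (D.memLp_sub_aStar (hA ha))).ae_eq
        (Eventually.of_forall fun x => ?_)
      simp
    rw [hmem.eLpNorm_eq_integral_rpow_norm (by norm_num) (by norm_num), Real.sqrt_eq_rpow]
    simp
  have hint : Tendsto (fun n => ∫ x in Ω, (s n x - a x) ^ 2) atTop (𝓝 0) :=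
    squeeze_zero (fun n => integral_nonneg fun _ => sq_nonneg _) hle hε
  simp only [heq]
  simpa using ENNReal.tendsto_ofReal hint.sqrt

end TikhonovData

end RobinTikhonov

theorem theorem2p2 {M : ℕ} (hM : 1 ≤ M) (Ω Ω₁ : Set (RobinTikhonov.E M))
    (hΩ : IsOpen Ω) (hΩb : Bornology.IsBounded Ω)
    (hΩ₁ : IsOpen Ω₁) (hΩ₁c : IsConnected Ω₁) (hsub : Ω₁ ⊆ Ω)
    (hLip : RobinTikhonov.HasLipschitzBoundary Ω₁)
    (γ aLow aUp bUp CF ρ : ℝ) (hγ : 0 < γ) (haLow : 0 < aLow) (haUp : aLow < aUp)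
    (hCF : 0 < CF) (hF : RobinTikhonov.IsFriedrichsConstant Ω₁ CF)
    (hbUp : 0 < bUp) (hbCF : bUp < aLow * min 1 γ / CF) (hρ : 0 < ρ)
    (b f aStar : RobinTikhonov.E M → ℝ)
    (hbm : AEMeasurable b (RobinTikhonov.vol Ω))
    (hb : ∀ᵐ x ∂(RobinTikhonov.vol Ω), 0 < b x ∧ b x < bUp)
    (hf : MemLp f ⊤ (RobinTikhonov.vol Ω)) (haStar : MemLp aStar 2 (RobinTikhonov.vol Ω))
    (z : ℕ → RobinTikhonov.H1 Ω₁) (zδ : RobinTikhonov.H1 Ω₁) (hz : Tendsto z atTop (𝓝 zδ)) :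
    (∀ a ∈ RobinTikhonov.admissible Ω Ω₁ aLow aUp,
      ∃! u, RobinTikhonov.IsWeakSolution Ω₁ γ b f a u) ∧
    (∃ a ∈ RobinTikhonov.admissible Ω Ω₁ aLow aUp,
      IsMinOn (RobinTikhonov.tikhonov Ω Ω₁ γ ρ b f aStar zδ)
        (RobinTikhonov.admissible Ω Ω₁ aLow aUp) a) ∧
    ∀ A : Set (RobinTikhonov.E M → ℝ), A ⊆ RobinTikhonov.admissible Ω Ω₁ aLow aUp → Convex ℝ A →
      ∀ (a : ℕ → RobinTikhonov.E M → ℝ) (aδ : RobinTikhonov.E M → ℝ),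
        (∀ n, a n ∈ A ∧ IsMinOn (RobinTikhonov.tikhonov Ω Ω₁ γ ρ b f aStar (z n)) A (a n)) →
        (aδ ∈ A ∧ IsMinOn (RobinTikhonov.tikhonov Ω Ω₁ γ ρ b f aStar zδ) A aδ) →
        Tendsto (fun n => eLpNorm (a n - aδ) 2 (RobinTikhonov.vol Ω)) atTop (𝓝 0) := by

  have hD : RobinTikhonov.TikhonovData Ω Ω₁ γ aLow aUp bUp CF ρ b f aStar :=
    { finite_vol := isFiniteMeasure_restrict.2 hΩb.measure_lt_top.ne
      finite_surf := RobinTikhonov.isFiniteMeasure_surf hM hΩ₁ (hΩb.subset hsub) hLip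
      subset := hsub
      gamma_pos := hγ
      aLow_pos := haLow
      aLow_lt := haUp
      CF_pos := hCF
      friedrichs := hF
      bUp_pos := hbUp
      bUp_lt := hbCF
      rho_pos := hρ
      b_aemeasurable := hbm
      b_bound := hb
      f_memLp := hf
      aStar_memLp := haStar }
  exact ⟨fun a ha => hD.existsUnique_isWeakSolution ha, hD.exists_isMinOn zδ,
    fun A hA hconv a aδ ha haδ => hD.tendsto_of_isMinOn hA hconv hz (fun n => (ha n).1)
      (fun n => (ha n).2) haδ.1 haδ.2⟩
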